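/- Let $X$ be a real Banach lattice. A net $(x_\alpha)$ in $X$ is un-null, written $x_\alpha\xrightarrow{un}0$, if $\bigl\||x_\alpha|\wedge u\bigr\|\to 0$ for every $u\in X_+$; it is weakly null, written $x_\alpha\xrightarrow{w}0$, if it converges to $0$ in the weak topology of $X$. An atom of $X$ is a vector $a\ge 0$, $a\ne 0$, such that the ideal of $X$ generated by $a$ equals the linear span of $a$; $X$ is atomic if $X$ is the band generated by all its atoms; and $X$ is order continuous if $\|x_\alpha\|\to 0$ for every net $(x_\alpha)$ in $X$ with $x_\alpha\downarrow 0$ (decreasing with infimum $0$). Then the following are equivalent: 1. $x_\alpha\xrightarrow{w}0$ implies $x_\alpha\xrightarrow{un}0$ for every net $(x_\alpha)$ in $X$; 2. $x_n\xrightarrow{w}0$ implies $x_n\xrightarrow{un}0$ for every sequence $(x_n)$ in $X$; 3. $X$ is atomic and order continuous. -/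

import Mathlib

open Filter Topology

universe u v

namespace BanachLattice

section Order

variable {X : Type u} [AddCommGroup X] [Lattice X] [Module ℝ X]

/-- An (order) ideal of a vector lattice: a linear subspace `I` such that `x ∈ I` and
`|y| ≤ |x|` imply `y ∈ I`. -/
def IsOrderIdeal (I : Submodule ℝ X) : Prop :=
  ∀ ⦃x : X⦄, x ∈ I → ∀ ⦃y : X⦄, |y| ≤ |x| → y ∈ I

/-- A band of a vector lattice: an ideal `B` containing the supremum of each of its subsets
that has a supremum in the whole lattice. -/
def IsBand (B : Submodule ℝ X) : Prop :=
  IsOrderIdeal B ∧ ∀ ⦃S : Set X⦄, S ⊆ (B : Set X) → ∀ ⦃x : X⦄, IsLUB S x → x ∈ B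

/-- The principal ideal generated by `a`: the smallest ideal that contains `a`. -/
def principalIdeal (a : X) : Submodule ℝ X :=
  sInf {I : Submodule ℝ X | IsOrderIdeal I ∧ a ∈ I}

/-- The band generated by a set `S`: the smallest band that contains `S`. -/
def bandGenerated (S : Set X) : Submodule ℝ X :=
  sInf {B : Submodule ℝ X | IsBand B ∧ S ⊆ (B : Set X)}

/-- An atom of a vector lattice: a positive non-zero vector whose principal ideal is its
linear span. -/
def IsAtomVector (a : X) : Prop :=
  0 ≤ a ∧ a ≠ 0 ∧ principalIdeal a = Submodule.span ℝ {a}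

variable (X) in
/-- A vector lattice is atomic if it is the band generated by all its atoms. -/
def AtomicLattice : Prop :=
  bandGenerated {a : X | IsAtomVector a} = ⊤

end Order

section Norm

variable {X : Type u} [NormedAddCommGroup X] [Lattice X]

variable (X) in
/-- The norm is order continuous: every decreasing net with infimum `0` converges to `0` in norm.
Index sets in the universe of `X` suffice, since the range of such a net is
itself a downward directed set with infimum `0`. -/
def OrderContinuousNorm : Prop :=
  ∀ (ι : Type u) [Preorder ι] [IsDirectedOrder ι] [Nonempty ι] (x : ι → X),
    Antitone x → IsGLB (Set.range x) 0 → Tendsto x atTop (𝓝 0)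

/-- Un-convergence (unbounded norm convergence) of a family along a filter:
`|x i - a| ⊓ w` converges to `0` in norm for every `w ≥ 0`. -/
def UnTendsto {ι : Type v} (x : ι → X) (l : Filter ι) (a : X) : Prop :=
  ∀ w : X, 0 ≤ w → Tendsto (fun i => |x i - a| ⊓ w) l (𝓝 0)

/-- Weak convergence of a family along a filter: convergence in the weak topology. -/
def WeakTendsto [NormedSpace ℝ X] {ι : Type v} (x : ι → X) (l : Filter ι) (a : X) : Prop :=
  Tendsto (fun i => toWeakSpace ℝ X (x i)) l (𝓝 (toWeakSpace ℝ X a))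

end Norm

end BanachLattice

/-! (3 ⇒ 1) For a weakly null net `x`, the vectors `v` with `|x i| ⊓ |v| → 0` form a closed ideal,
which order continuity turns into a band. Each atom `a` lies in it: `a` has a continuous coordinate
functional `f`, and `|x i| ⊓ a ≤ |f (x i)| • a`. By atomicity the band is all of `X`.

(2 ⇒ 3) Positive vectors with partial sums below a fixed `u` are weakly null, hence norm null by
hypothesis. So bounded upward directed sets are norm Cauchy and have suprema in their closure
(`DirectedSupInClosure`), which yields order continuity. If `X` is not atomic, some `u > 0` has no
atom below it and carries a functional `f` strictly positive on `[0, u]`. Every `v` in `[0, u]` then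
splits into two disjoint components of equal `f`-mass, and iterating gives Rademacher vectors with
`|r n| = u`. They are weakly null: averages of `N` of them have `f`-mass at most `f u / √N`, and
small `f`-mass in `[0, u]` forces small norm. By hypothesis `u = |r n| ⊓ u → 0`, a contradiction. -/

namespace BanachLattice

/-! ### Disjointness in lattice-ordered groups. -/

section OrderedGroup

variable {G : Type u} [AddCommGroup G] [Lattice G] [IsOrderedAddMonoid G] {a b c : G}

theorem add_inf_le (ha : 0 ≤ a) (hb : 0 ≤ b) (hc : 0 ≤ c) : (a + b) ⊓ c ≤ a ⊓ c + b ⊓ c := by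
  simp only [add_inf, inf_add]
  refine le_inf (le_inf inf_le_left ?_) (le_inf ?_ ?_)
  · exact inf_le_right.trans (le_add_of_nonneg_right hb)
  · exact inf_le_right.trans (le_add_of_nonneg_left ha)
  · exact inf_le_right.trans (le_add_of_nonneg_right hc)

theorem add_inf_eq_zero (ha : 0 ≤ a) (hb : 0 ≤ b) (hc : 0 ≤ c) (hac : a ⊓ c = 0)
    (hbc : b ⊓ c = 0) : (a + b) ⊓ c = 0 :=
  le_antisymm (by simpa [hac, hbc] using add_inf_le ha hb hc) (le_inf (add_nonneg ha hb) hc)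

omit [IsOrderedAddMonoid G] in
theorem inf_eq_zero_of_le_left (ha : 0 ≤ a) (hb : 0 ≤ b) (hc : a ≤ c) (h : c ⊓ b = 0) :
    a ⊓ b = 0 :=
  le_antisymm (h ▸ inf_le_inf_right b hc) (le_inf ha hb)

theorem abs_add_of_disjoint (h : |a| ⊓ |b| = 0) : |a + b| = |a| + |b| := by
  have key : ∀ x y : G, |x| ⊓ |y| = 0 → |x| ≤ |x + y| := by
    intro x y hxy
    have h1 : |x| ≤ |x + y| + |y| := by
      simpa using abs_add_le (x + y) (-y)
    calc |x| = (|x + y| + |y|) ⊓ |x| := (inf_eq_right.2 h1).symm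
      _ ≤ |x + y| ⊓ |x| + |y| ⊓ |x| := add_inf_le (abs_nonneg _) (abs_nonneg _) (abs_nonneg _)
      _ = |x + y| ⊓ |x| := by rw [inf_comm |y|, hxy, add_zero]
      _ ≤ |x + y| := inf_le_left
  refine le_antisymm (abs_add_le a b) ?_
  rw [← inf_add_sup |a| |b|, h, zero_add]
  exact sup_le (key a b h) (add_comm b a ▸ key b a (inf_comm |a| |b| ▸ h))

end OrderedGroup

/-! ### Bands, atoms and disjoint complements in vector lattices. -/

section VectorLattice

variable {X : Type u} [AddCommGroup X] [Lattice X] [Module ℝ X]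

theorem isBand_sInf {𝓑 : Set (Submodule ℝ X)} (h : ∀ B ∈ 𝓑, IsBand B) : IsBand (sInf 𝓑) := by
  refine ⟨fun x hx y hxy => ?_, fun S hS x hx => ?_⟩
  · rw [Submodule.mem_sInf] at hx ⊢
    exact fun B hB => (h B hB).1 (hx B hB) hxy
  · rw [Submodule.mem_sInf]
    exact fun B hB => (h B hB).2 (fun s hs => (Submodule.mem_sInf.1 (hS hs)) B hB) hx

theorem isBand_bandGenerated (S : Set X) : IsBand (bandGenerated S) :=
  isBand_sInf fun _ hB => hB.1

theorem subset_bandGenerated (S : Set X) : S ⊆ (bandGenerated S : Set X) := fun _ ha =>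
  Submodule.mem_sInf.2 fun _ hB => hB.2 ha

variable [IsOrderedAddMonoid X]

theorem IsAtomVector.mem_span {a y : X} (ha : IsAtomVector a) (hy : 0 ≤ y) (hya : y ≤ a) :
    y ∈ Submodule.span ℝ {a} := by
  rw [← ha.2.2]
  refine Submodule.mem_sInf.2 fun I hI => hI.1 hI.2 ?_
  rwa [abs_of_nonneg hy, abs_of_nonneg ha.1]

variable [IsOrderedModule ℝ X]

theorem abs_real_smul (c : ℝ) (x : X) : |c • x| = |c| • |x| := by
  have key : ∀ (c : ℝ) (x : X), |c • x| ≤ |c| • |x| := by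
    intro c x
    rcases le_total 0 c with hc | hc
    · rw [abs_of_nonneg hc]
      refine abs_le'.2 ⟨by gcongr; exact le_abs_self x, ?_⟩
      rw [← smul_neg]
      gcongr
      exact neg_le_abs x
    · rw [abs_of_nonpos hc]
      have hc' : 0 ≤ -c := neg_nonneg.2 hc
      refine abs_le'.2 ⟨?_, ?_⟩
      · rw [← neg_smul_neg]
        gcongr
        exact neg_le_abs x
      · rw [← neg_smul]
        gcongr
        exact le_abs_self x
  refine le_antisymm (key c x) ?_
  rcases eq_or_ne c 0 with rfl | hc
  · simp
  · calc |c| • |x| = |c| • |c⁻¹ • c • x| := by rw [inv_smul_smul₀ hc]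
      _ ≤ |c| • |c⁻¹| • |c • x| := by gcongr; exact key _ _
      _ = |c • x| := by rw [abs_inv, smul_inv_smul₀ (abs_ne_zero.2 hc)]

theorem inf_smul_le {p q : X} (hp : 0 ≤ p) (hq : 0 ≤ q) {c : ℝ} (hc : 0 ≤ c) :
    p ⊓ c • q ≤ (1 + c) • (p ⊓ q) := by
  have h1 : (0 : ℝ) < 1 + c := by positivity
  have hle : (1 + c)⁻¹ • (p ⊓ c • q) ≤ p ⊓ q := by
    refine le_inf ?_ ?_
    · calc (1 + c)⁻¹ • (p ⊓ c • q) ≤ (1 + c)⁻¹ • p := by gcongr; exact inf_le_left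
        _ ≤ (1 : ℝ) • p := by
          apply smul_le_smul_of_nonneg_right _ hp
          exact inv_le_one_of_one_le₀ (by linarith)
        _ = p := one_smul _ _
    · calc (1 + c)⁻¹ • (p ⊓ c • q) ≤ (1 + c)⁻¹ • c • q := by gcongr; exact inf_le_right
        _ = ((1 + c)⁻¹ * c) • q := smul_smul _ _ _
        _ ≤ (1 : ℝ) • q := by
          apply smul_le_smul_of_nonneg_right _ hq
          rw [inv_mul_le_iff₀ h1]; linarith
        _ = q := one_smul _ _
  calc p ⊓ c • q = (1 + c) • (1 + c)⁻¹ • (p ⊓ c • q) := by rw [smul_inv_smul₀ h1.ne']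
    _ ≤ (1 + c) • (p ⊓ q) := by gcongr

theorem inf_smul_eq_zero {p q : X} (hp : 0 ≤ p) (hq : 0 ≤ q) {c : ℝ} (hc : 0 ≤ c)
    (h : p ⊓ q = 0) : p ⊓ c • q = 0 :=
  le_antisymm (by simpa [h] using inf_smul_le hp hq hc) (le_inf hp (smul_nonneg hc hq))

/-- If the span of `a` contained the interval `[0, a]`, rescaling would make it an ideal, hence the
principal ideal of `a`. -/
theorem exists_notMem_span_of_not_isAtomVector {a : X} (h0 : 0 ≤ a) (hne : a ≠ 0)
    (ha : ¬ IsAtomVector a) : ∃ x, 0 ≤ x ∧ x ≤ a ∧ x ∉ Submodule.span ℝ {a} := by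
  by_contra! H
  refine ha ⟨h0, hne, le_antisymm (sInf_le ⟨?_, Submodule.mem_span_singleton_self a⟩) ?_⟩
  · intro x hx y hxy
    obtain ⟨c, rfl⟩ := Submodule.mem_span_singleton.1 hx
    rw [abs_real_smul, abs_of_nonneg h0] at hxy
    have hc : (0 : ℝ) < |c| + 1 := by positivity
    have key : ∀ z : X, 0 ≤ z → z ≤ |y| → z ∈ Submodule.span ℝ {a} := by
      intro z hz hzy
      have hza : z ≤ (|c| + 1) • a := hzy.trans (hxy.trans (by gcongr; linarith))
      have := H ((|c| + 1)⁻¹ • z) (smul_nonneg (by positivity) hz) (by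
        calc (|c| + 1)⁻¹ • z ≤ (|c| + 1)⁻¹ • (|c| + 1) • a := by gcongr
          _ = a := inv_smul_smul₀ hc.ne' a)
      simpa [smul_inv_smul₀ hc.ne'] using Submodule.smul_mem _ (|c| + 1) this
    rw [← posPart_sub_negPart y]
    exact Submodule.sub_mem _ (key _ (posPart_nonneg _) (sup_le (le_abs_self y) (abs_nonneg y)))
      (key _ (negPart_nonneg _) (sup_le (neg_le_abs y) (abs_nonneg y)))
  · rw [Submodule.span_singleton_le_iff_mem]
    exact Submodule.mem_sInf.2 fun I hI => hI.2

/-- The vectors disjoint from a given positive vector. -/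
def disjointComplement (w : X) (hw : 0 ≤ w) : Submodule ℝ X where
  carrier := {x | |x| ⊓ w = 0}
  zero_mem' := by simpa using hw
  add_mem' {x y} hx hy := inf_eq_zero_of_le_left (abs_nonneg _) hw (abs_add_le x y)
    (add_inf_eq_zero (abs_nonneg _) (abs_nonneg _) hw hx hy)
  smul_mem' c x hx := by
    have hx : |x| ⊓ w = 0 := hx
    change |c • x| ⊓ w = 0
    rw [abs_real_smul, inf_comm]
    exact inf_smul_eq_zero hw (abs_nonneg x) (abs_nonneg c) (inf_comm |x| w ▸ hx)

theorem mem_disjointComplement {w x : X} {hw : 0 ≤ w} :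
    x ∈ disjointComplement w hw ↔ |x| ⊓ w = 0 := Iff.rfl

end VectorLattice

/-! ### Atomic and order continuous lattices: weakly null implies un-null. -/

section NormedLattice

variable {X : Type u} [NormedAddCommGroup X] [NormedSpace ℝ X] [Lattice X]

omit [Lattice X] in
theorem weakTendsto_zero_iff {ι : Type v} {x : ι → X} {l : Filter ι} :
    WeakTendsto x l 0 ↔ ∀ f : X →L[ℝ] ℝ, Tendsto (fun i => f (x i)) l (𝓝 0) := by
  have hind : IsInducing (fun (x : WeakSpace ℝ X) (f : X →L[ℝ] ℝ) => f x) := ⟨rfl⟩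
  rw [WeakTendsto, hind.tendsto_nhds_iff, tendsto_pi_nhds]
  refine forall_congr' fun f => ?_
  change Tendsto (fun i => f (x i)) l (𝓝 (f 0)) ↔ _
  rw [map_zero]

variable [IsOrderedAddMonoid X] [HasSolidNorm X]

omit [NormedSpace ℝ X] in
theorem norm_le_norm_of_nonneg_of_le {x y : X} (hx : 0 ≤ x) (hxy : x ≤ y) : ‖x‖ ≤ ‖y‖ :=
  norm_le_norm_of_abs_le_abs (by rwa [abs_of_nonneg hx, abs_of_nonneg (hx.trans hxy)])

/-- The vectors `v` such that `|x i| ⊓ |v|` tends to zero in norm. -/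
def unNullIdeal [IsOrderedModule ℝ X] {ι : Type v} (x : ι → X) (l : Filter ι) : Submodule ℝ X where
  carrier := {v | Tendsto (fun i => |x i| ⊓ |v|) l (𝓝 0)}
  zero_mem' := by simpa using tendsto_const_nhds
  add_mem' {v w} hv hw := by
    have h := (hv.add hw).norm
    simp only [add_zero, norm_zero] at h
    refine squeeze_zero_norm (fun i => ?_) h
    refine norm_le_norm_of_nonneg_of_le (le_inf (abs_nonneg _) (abs_nonneg _)) ?_
    refine (inf_le_inf_left _ (abs_add_le v w)).trans ?_
    simpa only [inf_comm] using add_inf_le (abs_nonneg v) (abs_nonneg w) (abs_nonneg (x i))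
  smul_mem' c v hv := by
    have hv : Tendsto (fun i => |x i| ⊓ |v|) l (𝓝 0) := hv
    have h := (hv.const_smul (1 + |c|)).norm
    simp only [smul_zero, norm_zero] at h
    refine squeeze_zero_norm (fun i => ?_) h
    refine norm_le_norm_of_nonneg_of_le (le_inf (abs_nonneg _) (abs_nonneg _)) ?_
    rw [abs_real_smul]
    exact inf_smul_le (abs_nonneg _) (abs_nonneg _) (abs_nonneg _)

variable [IsOrderedModule ℝ X]

theorem mem_unNullIdeal {ι : Type v} {x : ι → X} {l : Filter ι} {v : X} :
    v ∈ unNullIdeal x l ↔ Tendsto (fun i => |x i| ⊓ |v|) l (𝓝 0) := Iff.rfl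

theorem isOrderIdeal_unNullIdeal {ι : Type v} (x : ι → X) (l : Filter ι) :
    IsOrderIdeal (unNullIdeal x l) := by
  intro v hv w hwv
  have h := (mem_unNullIdeal.1 hv).norm
  rw [norm_zero] at h
  exact squeeze_zero_norm (fun i => norm_le_norm_of_nonneg_of_le
    (le_inf (abs_nonneg _) (abs_nonneg _)) (inf_le_inf_left _ hwv)) h

/-- `v ↦ |x i| ⊓ |v|` is 1-Lipschitz, uniformly in `i`. -/
theorem isClosed_unNullIdeal {ι : Type v} (x : ι → X) (l : Filter ι) :
    IsClosed (unNullIdeal x l : Set X) := by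
  refine isClosed_of_closure_subset fun v hv => ?_
  change Tendsto (fun i => |x i| ⊓ |v|) l (𝓝 0)
  rw [Metric.tendsto_nhds]
  intro ε hε
  obtain ⟨w, hw, hvw⟩ := Metric.mem_closure_iff.1 hv (ε / 2) (half_pos hε)
  filter_upwards [Metric.tendsto_nhds.1 (mem_unNullIdeal.1 hw) (ε / 2) (half_pos hε)] with i hi
  rw [dist_zero_right] at hi ⊢
  rw [dist_eq_norm] at hvw
  have h1 : ‖|x i| ⊓ |v| - |x i| ⊓ |w|‖ ≤ ‖v - w‖ := by
    rw [inf_comm _ |v|, inf_comm _ |w|]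
    exact (norm_inf_sub_inf_le_norm _ _ _).trans (norm_abs_sub_abs v w)
  linarith [norm_sub_norm_le (|x i| ⊓ |v|) (|x i| ⊓ |w|)]

omit [HasSolidNorm X] [IsOrderedModule ℝ X] in
-- The elements of `J` below a supremum `x` are directed upward and the differences `x - v` decrease
-- to `0`, so `x` is a norm limit of elements of `J`.
theorem IsOrderIdeal.isBand_of_isClosed (hX : OrderContinuousNorm X) {J : Submodule ℝ X}
    (hJ : IsOrderIdeal J) (hcl : IsClosed (J : Set X)) : IsBand J := by
  refine ⟨hJ, fun S hS x hx => ?_⟩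
  have habs : ∀ v ∈ J, |v| ∈ J := fun v hv => hJ hv (abs_abs v).le
  have hsup : ∀ v ∈ J, ∀ w ∈ J, v ⊔ w ∈ J := fun v hv w hw => by
    refine hJ (J.add_mem (habs v hv) (habs w hw)) ?_
    rw [abs_of_nonneg (add_nonneg (abs_nonneg v) (abs_nonneg w))]
    refine abs_le'.2 ⟨sup_le ?_ ?_, ?_⟩
    · exact (le_abs_self v).trans (le_add_of_nonneg_right (abs_nonneg w))
    · exact (le_abs_self w).trans (le_add_of_nonneg_left (abs_nonneg v))
    · rw [neg_sup]
      exact inf_le_left.trans ((neg_le_abs v).trans (le_add_of_nonneg_right (abs_nonneg w)))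
  rcases S.eq_empty_or_nonempty with rfl | ⟨s₀, hs₀⟩
  -- A supremum of the empty set is a least element, which can only be `0`.
  · have hbot : ∀ y, x ≤ y := fun y => by
      have h := isLUB_empty_iff.1 hx
      exact h y
    have h1 : x = 0 := le_antisymm (hbot 0) (by simpa using hbot (x + x))
    exact h1 ▸ J.zero_mem
  let I := {v : X // v ∈ J ∧ v ≤ x}
  have : Nonempty I := ⟨⟨s₀, hS hs₀, hx.1 hs₀⟩⟩
  have : IsDirectedOrder I := ⟨fun v w =>
    ⟨⟨v.1 ⊔ w.1, hsup _ v.2.1 _ w.2.1, sup_le v.2.2 w.2.2⟩, le_sup_left, le_sup_right⟩⟩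
  have hlim := hX I (fun v => x - v.1) (fun v w h => sub_le_sub_left (show v.1 ≤ w.1 from h) x) ⟨?_, ?_⟩
  · have h2 : Tendsto (fun v : I => v.1) atTop (𝓝 x) := by
      simpa using hlim.const_sub x
    exact hcl.mem_of_tendsto h2 (Eventually.of_forall fun v => v.2.1)
  · rintro _ ⟨v, rfl⟩
    exact sub_nonneg.2 v.2.2
  · intro w hw
    have h3 : x ≤ x - w := hx.2 fun s hs => by
      have := hw ⟨⟨s, hS hs, hx.1 hs⟩, rfl⟩
      exact le_sub_comm.1 this
    simpa using h3

theorem exists_isGreatest_smul_le {v x : X} (hv : 0 ≤ v) (hv0 : v ≠ 0) (hx : 0 ≤ x) :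
    ∃ s : ℝ, 0 ≤ s ∧ IsGreatest {t : ℝ | t • v ≤ x} s := by
  have hb : ∀ t ∈ {t : ℝ | t • v ≤ x}, t ≤ ‖x‖ / ‖v‖ := by
    intro t ht
    rcases le_total t 0 with h | h
    · exact h.trans (by positivity)
    · rw [le_div_iff₀ (norm_pos_iff.2 hv0)]
      have := norm_le_norm_of_nonneg_of_le (smul_nonneg h hv) ht
      rwa [norm_smul, Real.norm_of_nonneg h] at this
  have h0 : (0 : ℝ) ∈ {t : ℝ | t • v ≤ x} := by simpa using hx
  have hc : IsClosed {t : ℝ | t • v ≤ x} := isClosed_le (by fun_prop) continuous_const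
  exact ⟨sSup {t : ℝ | t • v ≤ x}, le_csSup ⟨_, hb⟩ h0, hc.csSup_mem ⟨0, h0⟩ ⟨_, hb⟩,
    fun t ht => le_csSup ⟨_, hb⟩ ht⟩

/-- For `x ≥ 0`, subtract the largest multiple of `a` below `x`. The infimum of the remainder with
`a` is a multiple of `a`, and a positive one would contradict maximality. -/
theorem IsAtomVector.exists_smul_add {a : X} (ha : IsAtomVector a) (x : X) :
    ∃ s : ℝ, ∃ y ∈ disjointComplement a ha.1, x = s • a + y := by
  have key : ∀ x : X, 0 ≤ x → ∃ s : ℝ, x - s • a ∈ disjointComplement a ha.1 := by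
    intro x hx
    obtain ⟨s, -, hs, hmax⟩ := exists_isGreatest_smul_le ha.1 ha.2.1 hx
    refine ⟨s, ?_⟩
    have hs : s • a ≤ x := hs
    have hy : 0 ≤ x - s • a := sub_nonneg.2 hs
    rw [mem_disjointComplement, abs_of_nonneg hy]
    have h0 : 0 ≤ (x - s • a) ⊓ a := le_inf hy ha.1
    obtain ⟨r, hr⟩ := Submodule.mem_span_singleton.1 (ha.mem_span h0 inf_le_right)
    have h1 : s + r ≤ s := hmax (by
      change (s + r) • a ≤ x
      rw [add_smul, hr]
      exact le_sub_iff_add_le'.1 inf_le_left)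
    refine le_antisymm ?_ h0
    rw [← hr]
    exact smul_nonpos_of_nonpos_of_nonneg (by linarith) ha.1
  obtain ⟨s, hs⟩ := key x⁺ (posPart_nonneg x)
  obtain ⟨t, ht⟩ := key x⁻ (negPart_nonneg x)
  refine ⟨s - t, _, Submodule.sub_mem _ hs ht, ?_⟩
  conv_lhs => rw [← posPart_sub_negPart x]
  rw [sub_smul]; abel

omit [HasSolidNorm X] in
theorem abs_smul_add_of_mem_disjointComplement {a y : X} {ha : 0 ≤ a}
    (hy : y ∈ disjointComplement a ha) (s : ℝ) : |s • a + y| = |s| • a + |y| := by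
  have h : s • a ∈ disjointComplement |y| (abs_nonneg y) :=
    Submodule.smul_mem _ _ (by
      rw [mem_disjointComplement, abs_of_nonneg ha, inf_comm]; exact hy)
  rw [abs_add_of_disjoint h, abs_real_smul, abs_of_nonneg ha]

/-- A linear functional vanishing on the disjoint complement but not at `a`, normalized, reads off
the coefficient of `a`. It is continuous because `|f x| • a ≤ |x|`. -/
theorem IsAtomVector.exists_coordinate {a : X} (ha : IsAtomVector a) :
    ∃ f : X →L[ℝ] ℝ, ∀ x, ∃ y ∈ disjointComplement a ha.1, x = f x • a + y := by
  have hna : a ∉ disjointComplement a ha.1 := by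
    rw [mem_disjointComplement, abs_of_nonneg ha.1, inf_idem]
    exact ha.2.1
  obtain ⟨g, hga, hg⟩ := Submodule.exists_le_ker_of_notMem hna
  have hrep : ∀ x, ∃ y ∈ disjointComplement a ha.1, x = ((g a)⁻¹ • g) x • a + y := by
    intro x
    obtain ⟨s, y, hy, rfl⟩ := ha.exists_smul_add x
    refine ⟨y, hy, ?_⟩
    have hgy : g y = 0 := hg hy
    have : ((g a)⁻¹ • g) (s • a + y) = s := by
      simp [hgy]; field_simp
    rw [this]
  refine ⟨((g a)⁻¹ • g).mkContinuous ‖a‖⁻¹ fun x => ?_, hrep⟩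
  obtain ⟨y, hy, hx⟩ := hrep x
  generalize ((g a)⁻¹ • g) x = s at hx ⊢
  rw [← div_eq_inv_mul, le_div_iff₀ (norm_pos_iff.2 ha.2.1), ← norm_smul]
  refine norm_le_norm_of_abs_le_abs ?_
  rw [hx, abs_smul_add_of_mem_disjointComplement hy, abs_real_smul, abs_of_nonneg ha.1]
  exact le_add_of_nonneg_right (abs_nonneg y)

theorem IsAtomVector.mem_unNullIdeal {a : X} (ha : IsAtomVector a) {ι : Type v} {x : ι → X}
    {l : Filter ι} (hx : WeakTendsto x l 0) : a ∈ unNullIdeal x l := by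
  obtain ⟨f, hf⟩ := ha.exists_coordinate
  have h := ((weakTendsto_zero_iff.1 hx f).norm).mul_const ‖a‖
  simp only [norm_zero, zero_mul] at h
  refine squeeze_zero_norm (fun i => ?_) h
  obtain ⟨y, hy, hxi⟩ := hf (x i)
  rw [← norm_smul, ← norm_abs_eq_norm (f (x i) • a)]
  refine norm_le_norm_of_nonneg_of_le (le_inf (abs_nonneg _) (abs_nonneg _)) ?_
  have hy : |y| ⊓ a = 0 := hy
  generalize f (x i) = s at hxi ⊢
  rw [hxi, abs_smul_add_of_mem_disjointComplement (ha := ha.1) hy, abs_real_smul, abs_of_nonneg ha.1]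
  refine (add_inf_le (smul_nonneg (abs_nonneg s) ha.1) (abs_nonneg y) ha.1).trans ?_
  rw [hy, add_zero]
  exact inf_le_left

theorem unTendsto_of_weakTendsto (hat : AtomicLattice X) (hoc : OrderContinuousNorm X)
    {ι : Type v} {x : ι → X} {l : Filter ι} (hx : WeakTendsto x l 0) : UnTendsto x l 0 := by
  have hband : bandGenerated {a : X | IsAtomVector a} ≤ unNullIdeal x l :=
    sInf_le ⟨(isOrderIdeal_unNullIdeal x l).isBand_of_isClosed hoc (isClosed_unNullIdeal x l),
      fun a ha => IsAtomVector.mem_unNullIdeal ha hx⟩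
  intro w hw
  have h : w ∈ unNullIdeal x l := hband (by rw [show bandGenerated _ = ⊤ from hat]; trivial)
  simpa [abs_of_nonneg hw] using BanachLattice.mem_unNullIdeal.1 h

end NormedLattice

/-! ### Suprema as norm limits, and strictly positive functionals. -/

section DirectedSuprema

variable {X : Type u} [NormedAddCommGroup X] [Lattice X]

variable (X) in
/-- Every nonempty upward directed set that is bounded above has a supremum, and this supremum
is a norm limit of elements of the set. -/
def DirectedSupInClosure : Prop :=
  ∀ S : Set X, S.Nonempty → DirectedOn (· ≤ ·) S → BddAbove S → ∃ s ∈ closure S, IsLUB S s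

variable [IsOrderedAddMonoid X] [HasSolidNorm X]

/-- Signed partial sums stay within `[-u, u]`; choosing the signs of `f (d i)` bounds `∑ |f (d i)|`
by `‖f‖ * ‖u‖`. -/
theorem weakTendsto_zero_of_sum_range_le [NormedSpace ℝ X] {d : ℕ → X} {u : X}
    (h0 : ∀ n, 0 ≤ d n) (hsum : ∀ n, ∑ i ∈ Finset.range n, d i ≤ u) : WeakTendsto d atTop 0 := by
  rw [weakTendsto_zero_iff]
  intro f
  have hs : Summable fun n => |f (d n)| := by
    refine summable_of_sum_range_le (c := ‖f‖ * ‖u‖) (fun n => abs_nonneg _) fun n => ?_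
    let ε : ℕ → ℤ := fun i => if 0 ≤ f (d i) then 1 else -1
    have h1 : ∀ i, |f (d i)| = f (ε i • d i) := by
      intro i
      by_cases h : 0 ≤ f (d i)
      · simp [ε, h, abs_of_nonneg h]
      · simp [ε, h, abs_of_neg (not_le.1 h)]
    have h2 : ∀ i, |ε i • d i| ≤ d i := by
      intro i
      by_cases h : 0 ≤ f (d i)
      · simp [ε, h, abs_of_nonneg (h0 i)]
      · simp [ε, h, abs_of_nonneg (h0 i)]
    have h3 : |∑ i ∈ Finset.range n, ε i • d i| ≤ |u| := by
      refine le_trans ?_ ((hsum n).trans (le_abs_self u))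
      refine le_trans ?_ (Finset.sum_le_sum fun i _ => h2 i)
      exact Finset.le_sum_of_subadditive (fun x : X => |x|) abs_zero.le abs_add_le _ _
    calc ∑ i ∈ Finset.range n, |f (d i)| = f (∑ i ∈ Finset.range n, ε i • d i) := by
          rw [map_sum]; exact Finset.sum_congr rfl fun i _ => h1 i
      _ ≤ ‖f (∑ i ∈ Finset.range n, ε i • d i)‖ := Real.le_norm_self _
      _ ≤ ‖f‖ * ‖∑ i ∈ Finset.range n, ε i • d i‖ := f.le_opNorm _
      _ ≤ ‖f‖ * ‖u‖ := by
          gcongr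
          exact norm_le_norm_of_abs_le_abs h3
  exact (tendsto_zero_iff_abs_tendsto_zero _).2 hs.tendsto_atTop_zero

theorem directedSupInClosure_of_weak_imp_un [NormedSpace ℝ X] [CompleteSpace X]
    (H : ∀ x : ℕ → X, WeakTendsto x atTop 0 → UnTendsto x atTop 0) :
    DirectedSupInClosure X := by
  rintro S ⟨x₀, hx₀⟩ hdir ⟨b, hb⟩
  -- Otherwise `S` contains an increasing sequence with steps of norm at least `ε`. The steps sum to
  -- at most `b - x 0`, so they are weakly null; truncation by `b - x 0` does not change them, so
  -- un-null means norm null.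
  have osc : ∀ ε > 0, ∃ x ∈ S, ∀ y ∈ S, x ≤ y → ‖y - x‖ < ε := by
    by_contra! hcon
    obtain ⟨ε, hε, hcon⟩ := hcon
    choose! F hFS hF using hcon
    let x : ℕ → X := fun n => F^[n] x₀
    have hxS : ∀ n, x n ∈ S := by
      intro n
      induction n with
      | zero => exact hx₀
      | succ n ih =>
        change F^[n + 1] x₀ ∈ S
        rw [Function.iterate_succ_apply']
        exact hFS _ ih
    have hsucc : ∀ n, x (n + 1) = F (x n) := fun n => Function.iterate_succ_apply' F n x₀
    have hpos : ∀ n, 0 ≤ x (n + 1) - x n := fun n => by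
      rw [hsucc, sub_nonneg]; exact (hF _ (hxS n)).1
    have hsum : ∀ n, ∑ i ∈ Finset.range n, (x (i + 1) - x i) ≤ b - x 0 := fun n => by
      rw [Finset.sum_range_sub]
      exact sub_le_sub_right (hb (hxS n)) _
    have hun := H _ (weakTendsto_zero_of_sum_range_le hpos hsum) (b - x 0)
      (sub_nonneg.2 (hb (hxS 0)))
    have heq : ∀ n, |x (n + 1) - x n - 0| ⊓ (b - x 0) = x (n + 1) - x n := fun n => by
      rw [sub_zero, abs_of_nonneg (hpos n), inf_eq_left]
      exact (Finset.single_le_sum (f := fun i => x (i + 1) - x i) (fun i _ => hpos i)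
        (Finset.self_mem_range_succ n)).trans (hsum (n + 1))
    simp only [heq] at hun
    have hlim := hun.norm
    rw [norm_zero] at hlim
    have := ge_of_tendsto' hlim fun n => by
      rw [hsucc]; exact (hF _ (hxS n)).2
    exact absurd this (not_le.2 hε)
  have : Nonempty S := ⟨⟨x₀, hx₀⟩⟩
  have : IsDirectedOrder S := directedOn_iff_isDirectedOrder.1 hdir
  have hcau : Cauchy (map (fun x : S => (x : X)) atTop) := by
    rw [Metric.cauchy_iff]
    refine ⟨inferInstance, fun ε hε => ?_⟩
    obtain ⟨x, hxS, hx⟩ := osc (ε / 2) (half_pos hε)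
    refine ⟨_, image_mem_map (Ici_mem_atTop (⟨x, hxS⟩ : S)), ?_⟩
    rintro _ ⟨y, hy, rfl⟩ _ ⟨z, hz, rfl⟩
    have h1 := hx y y.2 hy
    have h2 := hx z z.2 hz
    rw [← dist_eq_norm] at h1 h2
    exact (dist_triangle_right _ _ x).trans_lt (by linarith)
  obtain ⟨s, hs⟩ := CompleteSpace.complete hcau
  have hs : Tendsto (fun x : S => (x : X)) atTop (𝓝 s) := hs
  refine ⟨s, mem_closure_of_tendsto hs (Eventually.of_forall fun x => x.2), fun y hy => ?_,
    fun c hc => le_of_tendsto' hs fun x => hc x.2⟩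
  exact ge_of_tendsto hs ((eventually_ge_atTop (⟨y, hy⟩ : S)).mono fun x hx => hx)

theorem DirectedSupInClosure.orderContinuousNorm (hX : DirectedSupInClosure X) :
    OrderContinuousNorm X := by
  intro ι _ _ _ x hx hglb
  have hdir : DirectedOn (· ≤ ·) (Set.range fun i => -x i) := by
    rintro _ ⟨i, rfl⟩ _ ⟨j, rfl⟩
    obtain ⟨k, hik, hjk⟩ := exists_ge_ge i j
    exact ⟨_, ⟨k, rfl⟩, neg_le_neg (hx hik), neg_le_neg (hx hjk)⟩
  have hlub : IsLUB (Set.range fun i => -x i) 0 := by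
    refine ⟨?_, fun c hc => ?_⟩
    · rintro _ ⟨i, rfl⟩
      exact neg_nonpos.2 (hglb.1 ⟨i, rfl⟩)
    · have : -c ≤ 0 := hglb.2 (by
        rintro _ ⟨i, rfl⟩
        exact neg_le.1 (hc ⟨i, rfl⟩))
      simpa using this
  obtain ⟨s, hs, hs'⟩ := hX _ (Set.range_nonempty _) hdir ⟨0, hlub.1⟩
  obtain rfl := hs'.unique hlub
  rw [Metric.tendsto_nhds]
  intro ε hε
  obtain ⟨_, ⟨i, rfl⟩, hi⟩ := Metric.mem_closure_iff.1 hs ε hε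
  filter_upwards [eventually_ge_atTop i] with j hj
  rw [dist_zero_left, norm_neg] at hi
  rw [dist_zero_right]
  exact (norm_le_norm_of_nonneg_of_le (hglb.1 ⟨j, rfl⟩) (hx hj)).trans_lt hi

variable [NormedSpace ℝ X]

omit [HasSolidNorm X] in
-- Subtract from a positive `x ∉ B` its band projection, the supremum of `B ∩ [0, x]`.
theorem DirectedSupInClosure.exists_disjoint_of_isBand_ne_top (hX : DirectedSupInClosure X)
    {B : Submodule ℝ X} (hB : IsBand B) (hne : B ≠ ⊤) :
    ∃ u : X, 0 ≤ u ∧ u ≠ 0 ∧ ∀ b ∈ B, 0 ≤ b → b ≤ u → b = 0 := by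
  obtain ⟨x, hx, hxB⟩ : ∃ x : X, 0 ≤ x ∧ x ∉ B := by
    by_contra! h
    refine hne (Submodule.eq_top_iff'.2 fun x => ?_)
    rw [← posPart_sub_negPart x]
    exact B.sub_mem (h _ (posPart_nonneg x)) (h _ (negPart_nonneg x))
  let S : Set X := {y | y ∈ B ∧ 0 ≤ y ∧ y ≤ x}
  have hdir : DirectedOn (· ≤ ·) S := by
    rintro y ⟨hyB, hy, hyx⟩ z ⟨hzB, hz, hzx⟩
    refine ⟨y ⊔ z, ⟨hB.1 (B.add_mem hyB hzB) ?_, hy.trans le_sup_left, sup_le hyx hzx⟩,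
      le_sup_left, le_sup_right⟩
    rw [abs_of_nonneg (hy.trans le_sup_left), abs_of_nonneg (add_nonneg hy hz)]
    exact sup_le (le_add_of_nonneg_right hz) (le_add_of_nonneg_left hy)
  obtain ⟨s, -, hs⟩ := hX S ⟨0, B.zero_mem, le_rfl, hx⟩ hdir ⟨x, fun y hy => hy.2.2⟩
  have hsB : s ∈ B := hB.2 (fun y hy => hy.1) hs
  have hs0 : 0 ≤ s := hs.1 ⟨B.zero_mem, le_rfl, hx⟩
  have hsx : s ≤ x := hs.2 fun y hy => hy.2.2
  refine ⟨x - s, sub_nonneg.2 hsx, fun h => hxB (sub_eq_zero.1 h ▸ hsB), fun b hbB hb hbu => ?_⟩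
  have : b + s ≤ s := hs.1 ⟨B.add_mem hbB hsB, add_nonneg hb hs0, le_sub_iff_add_le.1 hbu⟩
  exact le_antisymm (by simpa using this) hb

variable [IsOrderedModule ℝ X]

/-- Hahn–Banach with the sublinear bound `‖x⁺‖`: it vanishes on negative vectors, which forces
positivity. -/
theorem exists_positive_functional {u : X} (hu : 0 ≤ u) (hu0 : u ≠ 0) :
    ∃ f : X →L[ℝ] ℝ, (∀ x, 0 ≤ x → 0 ≤ f x) ∧ 0 < f u := by
  have hposPart : ∀ x : X, ‖x⁺‖ ≤ ‖x‖ := fun x => norm_le_norm_of_abs_le_abs (by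
    rw [abs_of_nonneg (posPart_nonneg x)]
    exact sup_le (le_abs_self x) (abs_nonneg x))
  let p : X →ₗ.[ℝ] ℝ := LinearPMap.mkSpanSingleton u ‖u‖ hu0
  have hsmul : ∀ c : ℝ, 0 < c → ∀ x : X, ‖(c • x)⁺‖ = c * ‖x⁺‖ := by
    intro c hc x
    have h : (c • x)⁺ = c • x⁺ := by
      apply le_antisymm
      · exact sup_le (by gcongr; exact le_posPart x) (smul_nonneg hc.le (posPart_nonneg x))
      · rw [← le_inv_smul_iff_of_pos hc]
        refine sup_le ?_ (smul_nonneg (inv_nonneg.2 hc.le) (posPart_nonneg _))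
        rw [le_inv_smul_iff_of_pos hc]
        exact le_posPart _
    rw [h, norm_smul, Real.norm_of_nonneg hc.le]
  have hadd : ∀ x y : X, ‖(x + y)⁺‖ ≤ ‖x⁺‖ + ‖y⁺‖ := by
    intro x y
    refine (norm_le_norm_of_nonneg_of_le (posPart_nonneg _) ?_).trans (norm_add_le x⁺ y⁺)
    exact sup_le (add_le_add (le_posPart x) (le_posPart y))
      (add_nonneg (posPart_nonneg x) (posPart_nonneg y))
  have hp : ∀ x : p.domain, p x ≤ ‖(x : X)⁺‖ := by
    rintro ⟨x, hx⟩
    obtain ⟨c, rfl⟩ := Submodule.mem_span_singleton.1 hx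
    have h1 : p ⟨c • u, hx⟩ = c * ‖u‖ := LinearPMap.mkSpanSingleton'_apply _ _ _ _ _
    rw [h1]
    rcases le_total 0 c with hc | hc
    · rw [posPart_of_nonneg (smul_nonneg hc hu), norm_smul, Real.norm_of_nonneg hc]
    · exact (mul_nonpos_of_nonpos_of_nonneg hc (norm_nonneg u)).trans (norm_nonneg _)
  obtain ⟨g, hgu, hg⟩ := exists_extension_of_le_sublinear p (fun x => ‖x⁺‖) hsmul hadd hp
  have hpos : ∀ x, 0 ≤ x → 0 ≤ g x := fun x hx => by
    have := hg (-x)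
    rw [posPart_eq_zero.2 (neg_nonpos.2 hx), norm_zero, map_neg] at this
    linarith
  refine ⟨g.mkContinuous 1 fun x => ?_, hpos, ?_⟩
  · rw [one_mul, Real.norm_eq_abs]
    refine abs_le'.2 ⟨(hg x).trans (hposPart x), ?_⟩
    rw [← map_neg, ← norm_neg]
    exact (hg _).trans (hposPart _)
  · have h1 : g u = ‖u‖ := (hgu ⟨u, Submodule.mem_span_singleton_self u⟩).trans
      (LinearPMap.mkSpanSingleton_apply ℝ ℝ hu0 ‖u‖)
    exact h1.symm ▸ norm_pos_iff.2 hu0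

omit [HasSolidNorm X] [IsOrderedModule ℝ X] in
theorem monotone_of_nonneg {f : X →L[ℝ] ℝ} (hf : ∀ x, 0 ≤ x → 0 ≤ f x) : Monotone f :=
  fun x y h => by simpa using hf _ (sub_nonneg.2 h)

/-- Remove from `u` the largest element `s` of `[0, u]` on which `f` vanishes; `f s = 0` survives
because `s` is a norm limit. -/
theorem DirectedSupInClosure.exists_strictly_positive (hX : DirectedSupInClosure X) {u : X}
    (hu : 0 ≤ u) (hu0 : u ≠ 0) :
    ∃ v : X, 0 ≤ v ∧ v ≤ u ∧ v ≠ 0 ∧ ∃ f : X →L[ℝ] ℝ, (∀ x, 0 ≤ x → 0 ≤ f x) ∧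
      ∀ y, 0 ≤ y → y ≤ v → f y = 0 → y = 0 := by
  obtain ⟨f, hf, hfu⟩ := exists_positive_functional hu hu0
  have hmono := monotone_of_nonneg hf
  let S : Set X := {y | 0 ≤ y ∧ y ≤ u ∧ f y = 0}
  have hdir : DirectedOn (· ≤ ·) S := by
    rintro y ⟨hy, hyu, hfy⟩ z ⟨hz, hzu, hfz⟩
    have h0 : 0 ≤ y ⊔ z := hy.trans le_sup_left
    refine ⟨y ⊔ z, ⟨h0, sup_le hyu hzu, le_antisymm ?_ (hf _ h0)⟩, le_sup_left, le_sup_right⟩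
    have := hmono (sup_le (le_add_of_nonneg_right hz) (le_add_of_nonneg_left hy) : y ⊔ z ≤ y + z)
    rwa [map_add, hfy, hfz, add_zero] at this
  obtain ⟨s, hscl, hs⟩ := hX S ⟨0, le_rfl, hu, map_zero f⟩ hdir ⟨u, fun y hy => hy.2.1⟩
  have hfs : f s = 0 := closure_minimal (s := S) (t := {x | f x = 0}) (fun y hy => hy.2.2)
    (isClosed_eq f.continuous continuous_const) hscl
  have hs0 : 0 ≤ s := hs.1 ⟨le_rfl, hu, map_zero f⟩
  have hsu : s ≤ u := hs.2 fun y hy => hy.2.1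
  refine ⟨u - s, sub_nonneg.2 hsu, sub_le_self u hs0, ?_, f, hf, fun y hy hyv hfy => ?_⟩
  · intro h
    rw [sub_eq_zero.1 h, hfs] at hfu
    exact lt_irrefl _ hfu
  · have : y + s ≤ s := hs.1 ⟨add_nonneg hy hs0, le_sub_iff_add_le.1 hyv, by
      rw [map_add, hfy, hfs, add_zero]⟩
    exact le_antisymm (by simpa using this) hy

omit [IsOrderedModule ℝ X] in
-- A Borel–Cantelli argument: the tail suprema `z n` decrease and `f (z n)` is at most a tail of the
-- series. Their infimum `-t` has `f`-mass zero, so it is `0`, and it is approached in norm.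
theorem DirectedSupInClosure.tendsto_zero_of_summable (hX : DirectedSupInClosure X) {u : X}
    {f : X →L[ℝ] ℝ} (hf : ∀ x, 0 ≤ x → 0 ≤ f x) (hfu : ∀ y, 0 ≤ y → y ≤ u → f y = 0 → y = 0)
    {y : ℕ → X} (hy : ∀ n, 0 ≤ y n) (hyu : ∀ n, y n ≤ u) (hs : Summable fun n => f (y n)) :
    Tendsto y atTop (𝓝 0) := by
  have hmono := monotone_of_nonneg hf
  let P : ℕ → ℕ → X := fun n => partialSups fun k => y (k + n)
  have hPu : ∀ n m, P n m ≤ u := fun n m => partialSups_le _ _ _ fun k _ => hyu _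
  have hPf : ∀ n m, f (P n m) ≤ ∑' k, f (y (k + n)) := by
    intro n m
    have h1 : P n m ≤ ∑ k ∈ Finset.range (m + 1), y (k + n) :=
      partialSups_le _ _ _ fun k hk =>
        Finset.single_le_sum (f := fun k => y (k + n)) (fun i _ => hy _)
          (Finset.mem_range.2 (Nat.lt_succ_of_le hk))
    refine (hmono h1).trans ?_
    rw [map_sum]
    exact ((summable_nat_add_iff n).2 hs).sum_le_tsum _ fun i _ => hf _ (hy _)
  have hz : ∀ n, ∃ z ∈ closure (Set.range (P n)), IsLUB (Set.range (P n)) z := fun n =>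
    hX _ (Set.range_nonempty _) (directedOn_range.2 (partialSups _).monotone.directed_le)
      ⟨u, by rintro _ ⟨m, rfl⟩; exact hPu n m⟩
  choose z hzcl hzlub using hz
  have hyz : ∀ n k, y (k + n) ≤ z n := fun n k =>
    (le_partialSups (fun k => y (k + n)) k).trans ((hzlub n).1 ⟨k, rfl⟩)
  have hyz' : ∀ n k, n ≤ k → y k ≤ z n := fun n k hnk => by
    simpa [Nat.sub_add_cancel hnk] using hyz n (k - n)
  have hz0 : ∀ n, 0 ≤ z n := fun n => (hy n).trans (hyz' n n le_rfl)
  have hzu : ∀ n, z n ≤ u := fun n => (hzlub n).2 (by rintro _ ⟨m, rfl⟩; exact hPu n m)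
  have hzf : ∀ n, f (z n) ≤ ∑' k, f (y (k + n)) := fun n =>
    closure_minimal (s := Set.range (P n)) (t := {x | f x ≤ ∑' k, f (y (k + n))})
      (by rintro _ ⟨m, rfl⟩; exact hPf n m) (isClosed_le f.continuous continuous_const) (hzcl n)
  have hzanti : Antitone z := fun n m hnm => (hzlub m).2 (by
    rintro _ ⟨j, rfl⟩
    exact partialSups_le _ _ _ fun k _ => hyz' n _ (by omega))
  obtain ⟨t, htcl, ht⟩ := hX (Set.range fun n => -z n) (Set.range_nonempty _)
    (directedOn_range.2 (Monotone.directed_le fun n m h => neg_le_neg (hzanti h)))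
    ⟨0, by rintro _ ⟨m, rfl⟩; exact neg_nonpos.2 (hz0 m)⟩
  have htz : ∀ n, -t ≤ z n := fun n => neg_le.1 (ht.1 ⟨n, rfl⟩)
  have ht0 : 0 ≤ -t := neg_nonneg.2 (ht.2 (by rintro _ ⟨m, rfl⟩; exact neg_nonpos.2 (hz0 m)))
  have hft : f (-t) ≤ 0 := ge_of_tendsto' (tendsto_sum_nat_add fun n => f (y n)) fun n =>
    (hmono (htz n)).trans (hzf n)
  have ht1 : -t = 0 := hfu _ ht0 ((htz 0).trans (hzu 0)) (le_antisymm hft (hf _ ht0))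
  rw [neg_eq_zero.1 ht1] at htcl
  rw [Metric.tendsto_atTop]
  intro ε hε
  obtain ⟨_, ⟨n, rfl⟩, hn⟩ := Metric.mem_closure_iff.1 htcl ε hε
  refine ⟨n, fun k hk => ?_⟩
  rw [dist_zero_left, norm_neg] at hn
  rw [dist_zero_right]
  exact (norm_le_norm_of_nonneg_of_le (hy k) (hyz' n k hk)).trans_lt hn

omit [IsOrderedModule ℝ X] in
theorem DirectedSupInClosure.exists_delta (hX : DirectedSupInClosure X) {u : X}
    {f : X →L[ℝ] ℝ} (hf : ∀ x, 0 ≤ x → 0 ≤ f x) (hfu : ∀ y, 0 ≤ y → y ≤ u → f y = 0 → y = 0)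
    {ε : ℝ} (hε : 0 < ε) : ∃ δ > 0, ∀ y, 0 ≤ y → y ≤ u → f y < δ → ‖y‖ < ε := by
  by_contra! h
  choose y hy hyu hfy hny using fun n : ℕ => h ((1 / 2) ^ n) (by positivity)
  have hs : Summable fun n => f (y n) :=
    Summable.of_nonneg_of_le (fun n => hf _ (hy n)) (fun n => (hfy n).le)
      summable_geometric_two
  have hlim := (hX.tendsto_zero_of_summable hf hfu hy hyu hs).norm
  rw [norm_zero] at hlim
  exact absurd (ge_of_tendsto' hlim hny) (not_le.2 hε)

end DirectedSuprema

/-! ### Components of a positive vector. -/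

section Component

variable {X : Type u} [AddCommGroup X] [Lattice X]

/-- `w` is a component (fragment) of `v`: it is positive, below `v`, and disjoint from `v - w`. -/
structure IsComponent (w v : X) : Prop where
  nonneg : 0 ≤ w
  le : w ≤ v
  disjoint : w ⊓ (v - w) = 0

variable [IsOrderedAddMonoid X] {v w z : X}

omit [IsOrderedAddMonoid X] in
theorem IsComponent.zero (hv : 0 ≤ v) : IsComponent 0 v := ⟨le_rfl, hv, by simpa using hv⟩

omit [IsOrderedAddMonoid X] in
theorem IsComponent.refl (hv : 0 ≤ v) : IsComponent v v := ⟨hv, le_rfl, by simpa using hv⟩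

theorem IsComponent.sub_nonneg (h : IsComponent w v) : 0 ≤ v - w := _root_.sub_nonneg.2 h.le

theorem IsComponent.sub (h : IsComponent w v) : IsComponent (v - w) v :=
  ⟨h.sub_nonneg, sub_le_self v h.nonneg, by rw [sub_sub_cancel, inf_comm]; exact h.disjoint⟩

theorem IsComponent.add (h : IsComponent w v) (h' : IsComponent z (v - w)) :
    IsComponent (w + z) v := by
  have hle : w + z ≤ v := by simpa [add_comm] using le_sub_iff_add_le'.1 h'.le
  have h0 : 0 ≤ v - (w + z) := _root_.sub_nonneg.2 hle
  refine ⟨add_nonneg h.nonneg h'.nonneg, hle, add_inf_eq_zero h.nonneg h'.nonneg h0 ?_ ?_⟩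
  · rw [inf_comm]
    refine inf_eq_zero_of_le_left h0 h.nonneg ?_ (inf_comm w _ ▸ h.disjoint)
    exact sub_le_sub_left (le_add_of_nonneg_right h'.nonneg) v
  · rw [← sub_sub]
    exact h'.disjoint

theorem IsComponent.trans (h : IsComponent z w) (h' : IsComponent w v) : IsComponent z v := by
  refine ⟨h.nonneg, h.le.trans h'.le, ?_⟩
  rw [← sub_add_sub_cancel v w z, inf_comm]
  refine add_inf_eq_zero h'.sub_nonneg h.sub_nonneg h.nonneg ?_ (inf_comm z _ ▸ h.disjoint)
  rw [inf_comm]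
  exact inf_eq_zero_of_le_left h.nonneg h'.sub_nonneg h.le h'.disjoint

theorem isClosed_setOf_isComponent {X : Type u} [NormedAddCommGroup X] [Lattice X]
    [IsOrderedAddMonoid X] [HasSolidNorm X] (v : X) : IsClosed {w : X | IsComponent w v} := by
  have : {w : X | IsComponent w v} = {w | 0 ≤ w} ∩ ({w | w ≤ v} ∩ {w | w ⊓ (v - w) = 0}) :=
    Set.ext fun w => ⟨fun h => ⟨h.1, h.2, h.3⟩, fun h => ⟨h.1, h.2.1, h.2.2⟩⟩
  rw [this]
  exact (isClosed_le continuous_const continuous_id).inter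
    ((isClosed_le continuous_id continuous_const).inter
      (isClosed_eq (by fun_prop) continuous_const))

end Component

/-! ### Halving a vector in the absence of atoms. -/

section Halving

variable {X : Type u} [NormedAddCommGroup X] [NormedSpace ℝ X] [Lattice X] [IsOrderedAddMonoid X]
  [IsOrderedModule ℝ X] [HasSolidNorm X]

/-- The component of `v` in the band generated by `p`. -/
theorem DirectedSupInClosure.exists_component (hX : DirectedSupInClosure X) {p v : X}
    (hp : 0 ≤ p) (hpv : p ≤ v) :
    ∃ w, IsComponent w v ∧ p ≤ w ∧ ∀ q, 0 ≤ q → p ⊓ q = 0 → w ⊓ q = 0 := by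
  have hv := hp.trans hpv
  let P : ℕ → X := fun n => v ⊓ n • p
  have hP : Monotone P := fun n m h => inf_le_inf_left _ (nsmul_le_nsmul_left hp h)
  obtain ⟨w, hwcl, hw⟩ := hX (Set.range P) (Set.range_nonempty _)
    (directedOn_range.2 hP.directed_le) ⟨v, by rintro _ ⟨n, rfl⟩; exact inf_le_left⟩
  have hdisj : ∀ q, 0 ≤ q → p ⊓ q = 0 → w ⊓ q = 0 := by
    intro q hq hpq
    refine closure_minimal (s := Set.range P) (t := {z | z ⊓ q = 0}) ?_
      (isClosed_eq (by fun_prop) continuous_const) hwcl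
    rintro _ ⟨n, rfl⟩
    refine inf_eq_zero_of_le_left (le_inf hv (nsmul_nonneg hp n)) hq inf_le_right ?_
    rw [← Nat.cast_smul_eq_nsmul ℝ, inf_comm]
    exact inf_smul_eq_zero hq hp n.cast_nonneg (inf_comm p q ▸ hpq)
  have hpw : p ≤ w := by
    have h1 : P 1 ≤ w := hw.1 ⟨1, rfl⟩
    simpa [P, inf_eq_right.2 hpv] using h1
  have hwv : w ≤ v := hw.2 (by rintro _ ⟨n, rfl⟩; exact inf_le_left)
  refine ⟨w, ⟨hp.trans hpw, hwv, hdisj _ (sub_nonneg.2 hwv) ?_⟩, hpw, hdisj⟩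
  have h0 : 0 ≤ p ⊓ (v - w) := le_inf hp (sub_nonneg.2 hwv)
  refine le_antisymm ?_ h0
  -- `P n + p ⊓ (v - w) ≤ P (n + 1)`, so `w - p ⊓ (v - w)` still bounds every `P n`; hence `p` is
  -- disjoint from `v - w`.
  have h1 : w ≤ w - p ⊓ (v - w) := hw.2 (by
    rintro _ ⟨n, rfl⟩
    rw [le_sub_iff_add_le]
    refine le_trans (le_inf ?_ ?_) (hw.1 ⟨n + 1, rfl⟩)
    · calc P n + p ⊓ (v - w) ≤ w + (v - w) := add_le_add (hw.1 ⟨n, rfl⟩) inf_le_right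
        _ = v := by abel
    · rw [succ_nsmul]
      exact add_le_add inf_le_right inf_le_left)
  simpa using h1

/-- Cut at a level `t` where `y - t • v` has nonzero positive and negative parts; the band of the
positive part gives the component. -/
theorem DirectedSupInClosure.exists_proper_component (hX : DirectedSupInClosure X) {v : X}
    (hv : 0 ≤ v) (hv0 : v ≠ 0) (hat : ¬ IsAtomVector v) :
    ∃ w, IsComponent w v ∧ w ≠ 0 ∧ w ≠ v := by
  obtain ⟨x, hx, hxv, hspan⟩ := exists_notMem_span_of_not_isAtomVector hv hv0 hat
  obtain ⟨s, hs0, hs, hmax⟩ := exists_isGreatest_smul_le hv hv0 hx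
  have hs : s • v ≤ x := hs
  let y := x - s • v
  have hy : 0 ≤ y := sub_nonneg.2 hs
  have hyv : y ≤ v := (sub_le_self x (smul_nonneg hs0 hv)).trans hxv
  have hy0 : y ≠ 0 := fun h => hspan (by
    rw [sub_eq_zero.1 h]
    exact Submodule.smul_mem _ _ (Submodule.mem_span_singleton_self v))
  have hvn := norm_pos_iff.2 hv0
  have hyn := norm_pos_iff.2 hy0
  -- `‖t • v‖ = ‖y‖ / 2` excludes `y ≤ t • v`, while maximality of `s` excludes `t • v ≤ y`.
  let t := ‖y‖ / (2 * ‖v‖)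
  have ht : 0 < t := by positivity
  let p := (y - t • v)⁺
  let q := (y - t • v)⁻
  have hp : 0 ≤ p := posPart_nonneg _
  have hq : 0 ≤ q := negPart_nonneg _
  have hpq : p ⊓ q = 0 := posPart_inf_negPart_eq_zero _
  have hp0 : p ≠ 0 := by
    intro h
    have h1 : y ≤ t • v := sub_nonpos.1 (posPart_eq_zero.1 h)
    have h2 := norm_le_norm_of_nonneg_of_le hy h1
    rw [norm_smul, Real.norm_of_nonneg ht.le] at h2
    have h3 : t * ‖v‖ = ‖y‖ / 2 := by simp only [t]; field_simp
    linarith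
  have hq0 : q ≠ 0 := by
    intro h
    have h1 : t • v ≤ y := sub_nonneg.1 (negPart_eq_zero.1 h)
    have h2 : s + t ≤ s := hmax (by
      change (s + t) • v ≤ x
      rw [add_smul]
      exact le_sub_iff_add_le'.1 h1)
    linarith
  have hpv : p ≤ v := sup_le ((sub_le_self y (smul_nonneg ht.le hv)).trans hyv) hv
  have hqv : q ≤ t • v := sup_le (by rw [neg_sub]; exact sub_le_self _ hy) (smul_nonneg ht.le hv)
  obtain ⟨w, hw, hpw, hdisj⟩ := hX.exists_component hp hpv
  refine ⟨w, hw, fun h => hp0 (le_antisymm (h ▸ hpw) hp), ?_⟩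
  rintro rfl
  refine hq0 ?_
  rw [← inf_eq_left.2 hqv]
  exact inf_smul_eq_zero hq hv ht.le (inf_comm w q ▸ hdisj q hq hpq)

variable {u : X}

/-- Split repeatedly and keep the piece of smaller `f`-value. -/
theorem DirectedSupInClosure.exists_small_component (hX : DirectedSupInClosure X)
    (hat : ∀ v, 0 ≤ v → v ≤ u → v ≠ 0 → ¬ IsAtomVector v) (f : X →L[ℝ] ℝ) {v : X} (hv : 0 ≤ v)
    (hvu : v ≤ u) (hv0 : v ≠ 0) (n : ℕ) :
    ∃ w, IsComponent w v ∧ w ≠ 0 ∧ f w ≤ f v / 2 ^ n := by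
  induction n with
  | zero => exact ⟨v, .refl hv, hv0, by simp⟩
  | succ n ih =>
    obtain ⟨w, hw, hw0, hfw⟩ := ih
    obtain ⟨z, hz, hz0, hzw⟩ := hX.exists_proper_component hw.nonneg hw0
      (hat w hw.nonneg (hw.le.trans hvu) hw0)
    have h2 : f v / 2 ^ (n + 1) = f v / 2 ^ n / 2 := by rw [pow_succ, div_div]
    rcases le_total (f z) (f w / 2) with h | h
    · exact ⟨z, hz.trans hw, hz0, by linarith⟩
    · refine ⟨w - z, hz.sub.trans hw, fun h => hzw (sub_eq_zero.1 h).symm, ?_⟩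
      rw [map_sub]
      linarith

/-- Zorn gives a maximal component `m` with at most half the mass; if it had less, a small component
of `v - m` could be added. -/
theorem DirectedSupInClosure.exists_half_component (hX : DirectedSupInClosure X)
    (hat : ∀ v, 0 ≤ v → v ≤ u → v ≠ 0 → ¬ IsAtomVector v) {f : X →L[ℝ] ℝ}
    (hf : ∀ x, 0 ≤ x → 0 ≤ f x) {v : X} (hv : 0 ≤ v) (hvu : v ≤ u) :
    ∃ w, IsComponent w v ∧ f w = f v / 2 := by
  let Z : Set X := {w | IsComponent w v} ∩ {w | f w ≤ f v / 2}
  have hZ : IsClosed Z :=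
    (isClosed_setOf_isComponent v).inter (isClosed_le f.continuous continuous_const)
  have hfv := hf v hv
  obtain ⟨m, -, hm⟩ := zorn_le_nonempty₀ Z (fun c hc hchain y hy => by
    obtain ⟨s, hscl, hs⟩ := hX c ⟨y, hy⟩ hchain.directedOn ⟨v, fun w hw => (hc hw).1.le⟩
    exact ⟨s, closure_minimal hc hZ hscl, hs.1⟩) 0
    ⟨.zero hv, by change f 0 ≤ _; rw [map_zero]; positivity⟩
  obtain ⟨hmv, hfm⟩ := hm.prop
  have hfm : f m ≤ f v / 2 := hfm
  refine ⟨m, hmv, le_antisymm hfm ?_⟩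
  by_contra! hlt
  have hne : v - m ≠ 0 := fun h => by
    rw [← sub_eq_zero.1 h] at hlt
    linarith
  obtain ⟨n, hn⟩ : ∃ n : ℕ, f (v - m) * (1 / 2) ^ n < f v / 2 - f m := by
    have := ((tendsto_pow_atTop_nhds_zero_of_lt_one (r := (1 / 2 : ℝ)) (by norm_num)
      (by norm_num)).const_mul (f (v - m)))
    rw [mul_zero] at this
    exact (this.eventually_lt_const (sub_pos.2 hlt)).exists
  obtain ⟨w, hw, hw0, hfw⟩ := hX.exists_small_component hat f hmv.sub_nonneg
    ((sub_le_self v hmv.nonneg).trans hvu) hne n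
  have hmem : m + w ∈ Z := ⟨hmv.add hw, by
    change f (m + w) ≤ _
    rw [map_add]
    have : f (v - m) * (1 / 2) ^ n = f (v - m) / 2 ^ n := by
      rw [one_div, inv_pow, div_eq_mul_inv]
    linarith⟩
  have hle : m + w ≤ m := hm.le_of_ge hmem (le_add_of_nonneg_right hw.nonneg)
  exact hw0 (le_antisymm (by simpa using hle) hw.nonneg)

end Halving

/-! ### Rademacher vectors are weakly null. -/

section Rademacher

variable {X : Type u} [AddCommGroup X]

/-- The Rademacher vectors obtained by iterating a splitting `v = h v + (v - h v)`. -/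
def rademacher (h : X → X) : ℕ → X → X
  | 0, v => h v - (v - h v)
  | n + 1, v => rademacher h n (h v) + rademacher h n (v - h v)

variable [Lattice X] [IsOrderedAddMonoid X] {h : X → X} {u v : X}

theorem abs_rademacher (hh : ∀ v, 0 ≤ v → v ≤ u → IsComponent (h v) v) (n : ℕ) (hv : 0 ≤ v)
    (hvu : v ≤ u) : |rademacher h n v| = v := by
  induction n generalizing v with
  | zero =>
    have hc := hh v hv hvu
    have h1 : |h v| ⊓ |-(v - h v)| = 0 := by
      rw [abs_neg, abs_of_nonneg hc.nonneg, abs_of_nonneg hc.sub_nonneg, hc.disjoint]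
    rw [rademacher, sub_eq_add_neg, abs_add_of_disjoint h1, abs_neg, abs_of_nonneg hc.nonneg,
      abs_of_nonneg hc.sub_nonneg]
    abel
  | succ n ih =>
    have hc := hh v hv hvu
    have h1 := ih hc.nonneg (hc.le.trans hvu)
    have h2 := ih hc.sub_nonneg (hc.sub.le.trans hvu)
    rw [rademacher, abs_add_of_disjoint (by rw [h1, h2, hc.disjoint]), h1, h2]
    abel

theorem half_add_sqrt_le (c d S : ℝ) (hS : 0 ≤ S) :
    (√((c + d) ^ 2 + S) + √((c - d) ^ 2 + S)) / 2 ≤ √(c ^ 2 + (d ^ 2 + S)) := by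
  apply Real.le_sqrt_of_sq_le
  have h1 := Real.sq_sqrt (show 0 ≤ (c + d) ^ 2 + S by positivity)
  have h2 := Real.sq_sqrt (show 0 ≤ (c - d) ^ 2 + S by positivity)
  nlinarith [sq_nonneg (√((c + d) ^ 2 + S) - √((c - d) ^ 2 + S))]

/-- The `L¹`–`L²` bound for Rademacher sums, without an `L²` structure. The term `c • v` makes the
induction close: on `h v` and `v - h v` the zeroth Rademacher vector is constant, turning `c` into
`c + d 0` and `c - d 0`. -/
theorem map_abs_sum_rademacher_le {X : Type u} [NormedAddCommGroup X] [NormedSpace ℝ X]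
    [Lattice X] [IsOrderedAddMonoid X] [IsOrderedModule ℝ X] {h : X → X} {u : X}
    (hh : ∀ v, 0 ≤ v → v ≤ u → IsComponent (h v) v) {f : X →L[ℝ] ℝ}
    (hf : ∀ x, 0 ≤ x → 0 ≤ f x) (hfh : ∀ v, 0 ≤ v → v ≤ u → f (h v) = f v / 2) (n : ℕ)
    (c : ℝ) (d : ℕ → ℝ) {v : X} (hv : 0 ≤ v) (hvu : v ≤ u) :
    f |c • v + ∑ j ∈ Finset.range n, d j • rademacher h j v|
      ≤ √(c ^ 2 + ∑ j ∈ Finset.range n, d j ^ 2) * f v := by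
  induction n generalizing c d v with
  | zero => simp [abs_real_smul, abs_of_nonneg hv, Real.sqrt_sq_eq_abs]
  | succ n ih =>
    have hc := hh v hv hvu
    set S := ∑ j ∈ Finset.range n, d (j + 1) ^ 2 with hS
    have hS0 : 0 ≤ S := Finset.sum_nonneg fun _ _ => sq_nonneg _
    have h1 := ih (c + d 0) (fun j => d (j + 1)) hc.nonneg (hc.le.trans hvu)
    have h2 := ih (c - d 0) (fun j => d (j + 1)) hc.sub_nonneg (hc.sub.le.trans hvu)
    have hsplit : c • v + ∑ j ∈ Finset.range (n + 1), d j • rademacher h j v =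
        ((c + d 0) • h v + ∑ j ∈ Finset.range n, d (j + 1) • rademacher h j (h v)) +
        ((c - d 0) • (v - h v) +
          ∑ j ∈ Finset.range n, d (j + 1) • rademacher h j (v - h v)) := by
      rw [Finset.sum_range_succ']
      simp only [rademacher, smul_add, Finset.sum_add_distrib]
      module
    rw [hsplit, Finset.sum_range_succ', ← hS, add_comm S]
    refine (monotone_of_nonneg hf (abs_add_le _ _)).trans ?_
    rw [map_add]
    have hfv2 : f (v - h v) = f v / 2 := by rw [map_sub, hfh v hv hvu]; ring
    rw [hfh v hv hvu, ← hS] at h1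
    rw [hfv2, ← hS] at h2
    refine (add_le_add h1 h2).trans ?_
    calc √((c + d 0) ^ 2 + S) * (f v / 2) + √((c - d 0) ^ 2 + S) * (f v / 2)
        = (√((c + d 0) ^ 2 + S) + √((c - d 0) ^ 2 + S)) / 2 * f v := by ring
      _ ≤ _ := by
        gcongr
        · exact hf v hv
        · exact half_add_sqrt_le _ _ _ hS0

theorem map_abs_sum_rademacher_finset_le {X : Type u} [NormedAddCommGroup X] [NormedSpace ℝ X]
    [Lattice X] [IsOrderedAddMonoid X] [IsOrderedModule ℝ X] {h : X → X} {u : X} (hu : 0 ≤ u)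
    (hh : ∀ v, 0 ≤ v → v ≤ u → IsComponent (h v) v) {f : X →L[ℝ] ℝ}
    (hf : ∀ x, 0 ≤ x → 0 ≤ f x) (hfh : ∀ v, 0 ≤ v → v ≤ u → f (h v) = f v / 2) (A : Finset ℕ) :
    f |∑ j ∈ A, rademacher h j u| ≤ √(A.card) * f u := by
  obtain ⟨n, hn⟩ := A.exists_nat_subset_range
  have := map_abs_sum_rademacher_le hh hf hfh n 0 (fun j => if j ∈ A then 1 else 0) hu le_rfl
  simpa [ite_smul, ite_pow, Finset.sum_ite_mem, Finset.inter_eq_right.2 hn] using this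

theorem DirectedSupInClosure.weakTendsto_rademacher {X : Type u} [NormedAddCommGroup X]
    [NormedSpace ℝ X] [Lattice X] [IsOrderedAddMonoid X] [IsOrderedModule ℝ X] [HasSolidNorm X]
    (hX : DirectedSupInClosure X) {h : X → X} {u : X} (hu : 0 ≤ u)
    (hh : ∀ v, 0 ≤ v → v ≤ u → IsComponent (h v) v) {f : X →L[ℝ] ℝ}
    (hf : ∀ x, 0 ≤ x → 0 ≤ f x) (hfu : ∀ y, 0 ≤ y → y ≤ u → f y = 0 → y = 0)
    (hfh : ∀ v, 0 ≤ v → v ≤ u → f (h v) = f v / 2) :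
    WeakTendsto (fun n => rademacher h n u) atTop 0 := by
  have hfin : ∀ (g : X →L[ℝ] ℝ) (ε : ℝ), 0 < ε → {n | ε ≤ g (rademacher h n u)}.Finite := by
    intro g ε hε
    by_contra hinf
    obtain ⟨δ, hδ, hsmall⟩ := hX.exists_delta hf hfu (ε := ε / (‖g‖ + 1)) (by positivity)
    -- With this `N`, `f u / √N < δ`: the average of `N` vectors has norm too small for `g` to reach
    -- `ε` on it.
    obtain ⟨N, hN⟩ := exists_nat_gt ((f u / δ) ^ 2)
    have hNpos : (0 : ℝ) < N := lt_of_le_of_lt (sq_nonneg _) hN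
    obtain ⟨A, hA, hcard⟩ := Set.Infinite.exists_subset_card_eq hinf N
    let a : X := (N : ℝ)⁻¹ • ∑ j ∈ A, rademacher h j u
    have habs : |a| = (N : ℝ)⁻¹ • |∑ j ∈ A, rademacher h j u| := by
      rw [abs_real_smul, abs_of_pos (inv_pos.2 hNpos)]
    have hle : |a| ≤ u := by
      rw [habs, inv_smul_le_iff_of_pos hNpos]
      calc |∑ j ∈ A, rademacher h j u| ≤ ∑ j ∈ A, |rademacher h j u| :=
            Finset.le_sum_of_subadditive (fun x : X => |x|) abs_zero.le abs_add_le _ _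
        _ = (N : ℝ) • u := by
            simp [abs_rademacher hh _ hu le_rfl, hcard, Nat.cast_smul_eq_nsmul]
    have hfa : f |a| < δ := by
      have h1 := map_abs_sum_rademacher_finset_le hu hh hf hfh A
      rw [hcard] at h1
      have hs : f u / δ < √N := Real.lt_sqrt_of_sq_lt hN
      have hspos : 0 < √(N : ℝ) := Real.sqrt_pos.2 hNpos
      rw [habs, map_smul, smul_eq_mul, inv_mul_lt_iff₀ hNpos]
      calc f |∑ j ∈ A, rademacher h j u| ≤ √N * f u := h1
        _ < √N * (√N * δ) := by gcongr; exact (div_lt_iff₀ hδ).1 hs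
        _ = N * δ := by rw [← mul_assoc, Real.mul_self_sqrt hNpos.le]
    have hna : ‖a‖ < ε / (‖g‖ + 1) := by
      rw [← norm_abs_eq_norm]
      exact hsmall _ (abs_nonneg a) hle hfa
    have hga : ε ≤ g a := by
      rw [map_smul, map_sum, smul_eq_mul, le_inv_mul_iff₀ hNpos]
      calc N * ε = ∑ _j ∈ A, ε := by simp [hcard]
        _ ≤ _ := Finset.sum_le_sum fun j hj => hA hj
    have h2 : g a ≤ (‖g‖ + 1) * ‖a‖ := by
      refine (Real.le_norm_self _).trans ((g.le_opNorm a).trans ?_)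
      gcongr
      linarith
    have h3 : ‖a‖ * (‖g‖ + 1) < ε := (lt_div_iff₀ (by positivity)).1 hna
    linarith
  rw [weakTendsto_zero_iff]
  intro g
  rw [Metric.tendsto_nhds]
  intro ε hε
  have h1 := (hfin g ε hε).union (hfin (-g) ε hε)
  rw [← Nat.cofinite_eq_atTop]
  filter_upwards [h1.compl_mem_cofinite] with n hn
  simp only [Set.mem_compl_iff, Set.mem_union, Set.mem_ofPred_eq, not_or, not_le,
    neg_apply] at hn
  rw [dist_zero_right, Real.norm_eq_abs, abs_lt]
  constructor <;> linarith [hn.1, hn.2]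

end Rademacher

/-! ### Atomicity and the equivalence. -/

theorem atomicLattice_of_weak_imp_un {X : Type u} [NormedAddCommGroup X] [NormedSpace ℝ X]
    [Lattice X] [IsOrderedAddMonoid X] [IsOrderedModule ℝ X] [HasSolidNorm X]
    (hX : DirectedSupInClosure X)
    (H : ∀ x : ℕ → X, WeakTendsto x atTop 0 → UnTendsto x atTop 0) : AtomicLattice X := by
  by_contra hne
  obtain ⟨u₀, hu₀, hu₀ne, hdisj⟩ :=
    hX.exists_disjoint_of_isBand_ne_top (isBand_bandGenerated _) hne
  obtain ⟨u, hu, huu₀, hune, f, hf, hfu⟩ := hX.exists_strictly_positive hu₀ hu₀ne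
  have hat : ∀ v, 0 ≤ v → v ≤ u → v ≠ 0 → ¬ IsAtomVector v := fun v hv hvu hv0 ha =>
    hv0 (hdisj v (subset_bandGenerated _ ha) hv (hvu.trans huu₀))
  choose! h hh hfh using fun v (hv : 0 ≤ v) (hvu : v ≤ u) =>
    hX.exists_half_component hat hf hv hvu
  have hun := H _ (hX.weakTendsto_rademacher hu hh hf hfu hfh) u hu
  simp only [sub_zero, abs_rademacher hh _ hu le_rfl, inf_idem] at hun
  exact hune (tendsto_nhds_unique tendsto_const_nhds hun)

end BanachLattice

theorem mainTheorem11 {X : Type u} [NormedAddCommGroup X] [NormedSpace ℝ X] [CompleteSpace X]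
    [Lattice X] [IsOrderedAddMonoid X] [IsOrderedModule ℝ X] [HasSolidNorm X] :
    List.TFAE [
      ∀ (ι : Type v) [Preorder ι] [IsDirectedOrder ι] [Nonempty ι] (x : ι → X),
        BanachLattice.WeakTendsto x atTop 0 → BanachLattice.UnTendsto x atTop 0,
      ∀ x : ℕ → X,
        BanachLattice.WeakTendsto x atTop 0 → BanachLattice.UnTendsto x atTop 0,
      BanachLattice.AtomicLattice X ∧ BanachLattice.OrderContinuousNorm X] := by
  tfae_have 1 → 2 := by
    intro H x hx
    -- Nets are indexed in universe `v`, so the sequence is reindexed by a lift of `ℕ`.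
    have hdown : Tendsto (ULift.down : ULift.{v} ℕ → ℕ) atTop atTop :=
      tendsto_atTop.2 fun n => (eventually_ge_atTop (ULift.up n)).mono fun m hm => hm
    have hup : Tendsto (ULift.up : ℕ → ULift.{v} ℕ) atTop atTop :=
      tendsto_atTop.2 fun n => (eventually_ge_atTop n.down).mono fun m hm => hm
    exact fun w hw => (H (ULift.{v} ℕ) (fun n => x n.down) (hx.comp hdown) w hw).comp hup
  tfae_have 2 → 3 := by
    intro H
    have hX := BanachLattice.directedSupInClosure_of_weak_imp_un H
    exact ⟨BanachLattice.atomicLattice_of_weak_imp_un hX H, hX.orderContinuousNorm⟩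
  tfae_have 3 → 1 := by
    intro h ι _ _ _ x hx
    exact BanachLattice.unTendsto_of_weakTendsto h.1 h.2 hx
  tfae_finish
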